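/- Let $V$ be a finite set. A signed graph $G$ on $V$ is given by a set $E(G)$ of signed edges $+ij$ and $-ij$, where $\{i,j\}$ is an unordered pair of vertices of $V$; loops ($i=j$) are allowed, and for a given pair $\{i,j\}$ either one, both or none of $+ij$, $-ij$ may be present. Let $k$ be a field. The edge ring $k[G]$ is the $k$-subalgebra of the Laurent polynomial ring $k[x_v^{\pm 1} : v\in V]$ generated by the monomials $x_ix_j$ for $+ij\in E(G)$ and $x_i^{-1}x_j^{-1}$ for $-ij\in E(G)$. A walk in $G$ is a sequence of consecutively incident edges; vertices and edges may repeat. It is sign-alternating if any two consecutive edges of it have opposite signs. A cycle is a closed walk of positive length without repeated edges and without repeated vertices other than its coinciding first and last vertex (so a loop is a cycle of length one); it is odd if its length is odd. $G$ satisfies the odd cycle condition if for every two odd cycles $C$ and $C'$ of $G$ at least one of the following holds: 1. $C$ and $C'$ lie in distinct connected components of $G$; 2. $C$ and $C'$ have a vertex in common; 3. there is a sign-alternating walk in $G$ from a vertex of $C$ to a vertex of $C'$. **Theorem.** $k[G]$ is normal (that is, an integrally closed domain) if and only if $G$ satisfies the odd cycle condition. -/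

import Mathlib

/-- A signed graph on the vertex set `V`: a set of signed edges, the pair `(1, s(i, j))` being the
edge `+ij` and `(-1, s(i, j))` the edge `-ij`. Loops are allowed. An ordinary graph with edge set
`E` and sign function `sgn` is the case `edges = {(sgn e, e) | e ∈ E}`; more generally `+ij` and
`-ij` may both be present. -/
@[ext]
structure SignedGraph (V : Type*) where
  edges : Set (ℤˣ × Sym2 V)

namespace SignedGraph

/-- Walks (sequences of incident edges) in a signed graph; vertices and edges may repeat. -/
inductive Walk {V : Type*} (G : SignedGraph V) : V → V → Type _
  | nil (u : V) : Walk G u u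
  | cons {u v w : V} (ε : ℤˣ) (h : (ε, s(u, v)) ∈ G.edges) (p : Walk G v w) : Walk G u w

namespace Walk

/-- The number of edges of a walk. -/
def length {V : Type*} {G : SignedGraph V} : {u v : V} → G.Walk u v → ℕ
  | _, _, nil _ => 0
  | _, _, cons _ _ p => p.length + 1

/-- The vertices of a walk, in order. -/
def support {V : Type*} {G : SignedGraph V} : {u v : V} → G.Walk u v → List V
  | _, _, nil u => [u]
  | u, _, cons _ _ p => u :: p.support

/-- The signed edges of a walk, in order. -/
def edgeList {V : Type*} {G : SignedGraph V} : {u v : V} → G.Walk u v → List (ℤˣ × Sym2 V)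
  | _, _, nil _ => []
  | u, _, cons (v := v) ε _ p => (ε, s(u, v)) :: p.edgeList

/-- A walk is sign-alternating if any two consecutive edges have opposite signs. -/
def IsAlternating {V : Type*} {G : SignedGraph V} {u v : V} (p : G.Walk u v) : Prop :=
  p.edgeList.IsChain fun e f => e.1 ≠ f.1

/-- A cycle: a closed walk of positive length without repeated edges, and without repeated
vertices except that the last vertex is the first. A loop is a cycle of length one. -/
structure IsCycle {V : Type*} {G : SignedGraph V} {u : V} (p : G.Walk u u) : Prop where
  length_pos : 0 < p.length
  edges_nodup : p.edgeList.Nodup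
  support_nodup : p.support.tail.Nodup

/-- A cycle of odd length. -/
def IsOddCycle {V : Type*} {G : SignedGraph V} {u : V} (p : G.Walk u u) : Prop :=
  p.IsCycle ∧ Odd p.length

end Walk

/-- Two vertices lie in the same connected component. -/
def SameComponent {V : Type*} (G : SignedGraph V) (u v : V) : Prop :=
  Nonempty (G.Walk u v)

/-- The odd cycle condition: any two odd cycles lie in distinct components, have a common vertex,
or are joined by a sign-alternating walk. -/
def OddCycleCondition {V : Type*} (G : SignedGraph V) : Prop :=
  ∀ (u v : V) (C : G.Walk u u) (C' : G.Walk v v), C.IsOddCycle → C'.IsOddCycle →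
    ¬ G.SameComponent u v ∨
    (∃ w, w ∈ C.support ∧ w ∈ C'.support) ∨
    (∃ i ∈ C.support, ∃ j ∈ C'.support, ∃ P : G.Walk i j, P.IsAlternating)

/-- The exponent vector `ε (e_i + e_j)` of the signed edge `ε ij`. -/
noncomputable def rho {V : Type*} : ℤˣ × Sym2 V → V →₀ ℤ
  | (ε, e) => (ε : ℤ) • Sym2.lift
      ⟨fun i j => Finsupp.single i 1 + Finsupp.single j 1, fun _ _ => add_comm _ _⟩ e

/-- The edge ring `k[G]`: the `k`-subalgebra of the Laurent polynomial ring
`k[x_v^{±1} : v ∈ V]`, which is the group algebra of `V →₀ ℤ`, generated by the monomials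
`x^(rho e) = (x_i x_j)^ε`, where `e = ε ij` is an edge of `G`. -/
noncomputable def edgeRing {V : Type*} (k : Type*) [Field k] (G : SignedGraph V) :
    Subalgebra k (AddMonoidAlgebra k (V →₀ ℤ)) :=
  Algebra.adjoin k ((fun e => AddMonoidAlgebra.single (rho e) 1) '' G.edges)

end SignedGraph

/-! The edge ring is spanned by the monomials whose exponents lie in the monoid S generated by the
vectors ε(e_i + e_j). As S is finitely generated, integral closedness of the ring amounts to
normality of S (`isNormal_of_isIntegrallyClosed`, `isIntegrallyClosed_of_isNormal`), a question
about ℤ^V.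

An alternating walk from i to j telescopes to ±e_i ± e_j, so it acts like an edge. An odd closed
walk has edge sum 2w, where w may lie outside S although w - e_x and w + e_x lie in S for every
vertex x on it (`Walk.half_rhoSum_sub_single_mem`). Hence two such half-sums add up to an element of
S when their walks share a vertex or are joined by an alternating walk.

If ma ∈ S, split a into signed unit vectors. A potential that is nonpositive on S yields Hall's
condition for permuting them along alternating walks (`exists_injective_alt`). Even orbits sum into
S; odd orbits sum to half-sums of odd closed walks. If a lies in the group of S, its coordinate sum
over each component is even, so the half-sums in a component are even in number and pair off under
the odd cycle condition.

Conversely, let w and z be the half-sums of two disjoint odd cycles in one component. Then w + z is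
in the group and 2(w + z) in S, so normality gives w + z ∈ S. Without an alternating walk between
the cycles, the potential spreading from the support of w vanishes on w + z, and its equality case
makes the coordinate sum of w even, though it is odd. -/

/-! ### Monomial subalgebras, leading exponents and normal monoids. -/

namespace AddMonoidAlgebra

/-- The subalgebra of `k[M]` of the elements with all exponents in the submonoid `S`. -/
def monomialSubalgebra (k : Type*) {M : Type*} [Field k] [AddCommMonoid M] (S : AddSubmonoid M) :
    Subalgebra k (AddMonoidAlgebra k M) where
  carrier := {f | ∀ a, f.coeff a ≠ 0 → a ∈ S}
  mul_mem' := by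
    classical
    intro f g hf hg a ha
    obtain ⟨b, hb, c, hc, rfl⟩ := Finset.mem_add.1
      (AddMonoidAlgebra.support_coeff_mul_subset f g (Finsupp.mem_support_iff.2 ha))
    exact S.add_mem (hf b (Finsupp.mem_support_iff.1 hb)) (hg c (Finsupp.mem_support_iff.1 hc))
  add_mem' := by
    intro f g hf hg a ha
    by_cases h : f.coeff a = 0
    · exact hg a (by simpa [h] using ha)
    · exact hf a h
  algebraMap_mem' := by
    classical
    intro r a ha
    have : a = 0 := by
      by_contra h
      apply ha
      simp [Ne.symm h]
    exact this ▸ S.zero_mem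

variable {k M : Type*} [Field k]

theorem mem_monomialSubalgebra [AddCommMonoid M] {S : AddSubmonoid M} {f : AddMonoidAlgebra k M} :
    f ∈ monomialSubalgebra k S ↔ ∀ a, f.coeff a ≠ 0 → a ∈ S := Iff.rfl

theorem single_mem_monomialSubalgebra [AddCommMonoid M] {S : AddSubmonoid M} {a : M} {r : k}
    (hr : r ≠ 0) : single a r ∈ monomialSubalgebra k S ↔ a ∈ S := by
  classical
  rw [mem_monomialSubalgebra]
  refine ⟨fun h => h a (by simpa using hr), fun h b hb => ?_⟩
  have : a = b := by
    by_contra hab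
    exact hb (by simp [hab])
  exact this ▸ h

theorem adjoin_single_eq_monomialSubalgebra [AddCommMonoid M] (s : Set M) :
    Algebra.adjoin k ((fun a => single a (1 : k)) '' s) =
      monomialSubalgebra k (AddSubmonoid.closure s) := by
  apply le_antisymm
  · rw [Algebra.adjoin_le_iff]
    rintro _ ⟨a, ha, rfl⟩
    exact (single_mem_monomialSubalgebra one_ne_zero).2 (AddSubmonoid.subset_closure ha)
  · intro f hf
    rw [← AddMonoidAlgebra.sum_coeff_single f]
    refine Subalgebra.sum_mem _ fun a ha => ?_
    have key : single a (1 : k) ∈ Algebra.adjoin k ((fun a => single a (1 : k)) '' s) := by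
      have haS := hf a (Finsupp.mem_support_iff.1 ha)
      clear ha
      induction haS using AddSubmonoid.closure_induction with
      | mem x hx => exact Algebra.subset_adjoin ⟨x, hx, rfl⟩
      | zero => exact one_mem _
      | add x y _ _ hx hy =>
        have := mul_mem hx hy
        rwa [AddMonoidAlgebra.single_mul_single, one_mul] at this
    have := Subalgebra.smul_mem _ key (f.coeff a)
    rwa [AddMonoidAlgebra.smul_single, smul_eq_mul, mul_one] at this

/-- `a` is the largest exponent of `f`. -/
def IsLeadingExponent [AddCommMonoid M] [LinearOrder M] (f : AddMonoidAlgebra k M) (a : M) : Prop :=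
  f.coeff a ≠ 0 ∧ ∀ b, f.coeff b ≠ 0 → b ≤ a

section Order

variable [AddCommMonoid M] [LinearOrder M]

theorem exists_isLeadingExponent {f : AddMonoidAlgebra k M} (hf : f ≠ 0) :
    ∃ a, IsLeadingExponent f a := by
  have hne : f.coeff.support.Nonempty := by
    rw [Finsupp.support_nonempty_iff]
    simpa using hf
  exact ⟨f.coeff.support.max' hne, Finsupp.mem_support_iff.1 (Finset.max'_mem _ _),
    fun b hb => Finset.le_max' _ _ (Finsupp.mem_support_iff.2 hb)⟩

theorem IsLeadingExponent.mul [IsOrderedCancelAddMonoid M] {f g : AddMonoidAlgebra k M} {a b : M}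
    (hf : IsLeadingExponent f a) (hg : IsLeadingExponent g b) :
    IsLeadingExponent (f * g) (a + b) := by
  classical
  constructor
  · have h : UniqueAdd f.coeff.support g.coeff.support a b := by
      intro c d hc hd h
      have hc' := hf.2 c (Finsupp.mem_support_iff.1 hc)
      have hd' := hg.2 d (Finsupp.mem_support_iff.1 hd)
      rcases hc'.lt_or_eq with hlt | rfl
      · exact absurd h (add_lt_add_of_lt_of_le hlt hd').ne
      · exact ⟨rfl, add_left_cancel h⟩
    rw [AddMonoidAlgebra.coeff_mul_add_of_uniqueAdd h]
    exact mul_ne_zero hf.1 hg.1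
  · intro c hc
    obtain ⟨x, hx, y, hy, rfl⟩ := Finset.mem_add.1
      (AddMonoidAlgebra.support_coeff_mul_subset f g (Finsupp.mem_support_iff.2 hc))
    exact add_le_add (hf.2 x (Finsupp.mem_support_iff.1 hx)) (hg.2 y (Finsupp.mem_support_iff.1 hy))

theorem IsLeadingExponent.mul_pow [IsOrderedCancelAddMonoid M] {f g : AddMonoidAlgebra k M} {a b : M}
    (hf : IsLeadingExponent f a) (hg : IsLeadingExponent g b) (n : ℕ) :
    IsLeadingExponent (f * g ^ n) (a + n • b) := by
  induction n with
  | zero => simpa using hf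
  | succ n ih =>
    have := ih.mul hg
    rwa [mul_assoc, ← pow_succ, add_assoc, ← succ_nsmul] at this

end Order

end AddMonoidAlgebra

/-- A submonoid of an abelian group is normal if it contains every element of the group it
generates of which it contains a positive multiple. -/
def AddSubmonoid.IsNormal {M : Type*} [AddCommGroup M] (S : AddSubmonoid M) : Prop :=
  ∀ a ∈ AddSubgroup.closure (S : Set M), ∀ m : ℕ, m ≠ 0 → m • a ∈ S → a ∈ S

theorem AddSubmonoid.exists_sub_of_mem_closure {M : Type*} [AddCommGroup M] {S : AddSubmonoid M}
    {a : M} (ha : a ∈ AddSubgroup.closure (S : Set M)) : ∃ b ∈ S, ∃ c ∈ S, a = b - c := by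
  induction ha using AddSubgroup.closure_induction with
  | mem x hx => exact ⟨x, hx, 0, S.zero_mem, by simp⟩
  | zero => exact ⟨0, S.zero_mem, 0, S.zero_mem, by simp⟩
  | add x y _ _ hx hy =>
    obtain ⟨b, hb, c, hc, rfl⟩ := hx
    obtain ⟨b', hb', c', hc', rfl⟩ := hy
    exact ⟨b + b', S.add_mem hb hb', c + c', S.add_mem hc hc', by abel⟩
  | neg x _ hx =>
    obtain ⟨b, hb, c, hc, rfl⟩ := hx
    exact ⟨c, hc, b, hb, by abel⟩

/-- Dickson's lemma for finitely generated submonoids. -/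
theorem AddSubmonoid.exists_lt_sub_mem_of_finite {M : Type*} [AddCommGroup M] {s : Set M}
    (hs : s.Finite) (u : ℕ → M) (hu : ∀ n, u n ∈ AddSubmonoid.closure s) :
    ∃ i j, i < j ∧ u j - u i ∈ AddSubmonoid.closure s := by
  have := hs.fintype
  choose c hc using fun n => AddSubmonoid.mem_closure_iff_of_fintype.1 (hu n)
  obtain ⟨i, j, hij, hle⟩ := wellQuasiOrdered_le (α := s → ℕ) c
  refine ⟨i, j, hij, ?_⟩
  have : u j - u i = ∑ e : s, (c j e - c i e) • (e : M) := by
    rw [hc j, hc i, ← Finset.sum_sub_distrib]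
    refine Finset.sum_congr rfl fun e _ => ?_
    rw [sub_eq_iff_eq_add, ← add_nsmul, Nat.sub_add_cancel (hle e)]
  rw [this]
  exact AddSubmonoid.sum_mem _ fun e _ => nsmul_mem (AddSubmonoid.subset_closure e.2) _

namespace AddMonoidAlgebra

variable {k M : Type*} [Field k]

/-- The leading exponents c + n • a of d * f ^ n all lie in the monoid, so Dickson's lemma puts a
positive multiple of a there, and normality puts a there. Removing the leading term of f keeps the
hypothesis, with the same d, by the binomial theorem. -/
theorem mem_monomialSubalgebra_of_mul_pow_mem [AddCommGroup M] [LinearOrder M]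
    [IsOrderedCancelAddMonoid M] {s : Set M} (hs : s.Finite)
    (hS : (AddSubmonoid.closure s).IsNormal) (f d : AddMonoidAlgebra k M) (hd : d ≠ 0)
    (h : ∀ n : ℕ, d * f ^ n ∈ monomialSubalgebra k (AddSubmonoid.closure s)) :
    f ∈ monomialSubalgebra k (AddSubmonoid.closure s) := by
  induction hn : f.coeff.support.card using Nat.strong_induction_on generalizing f with
  | _ N ih =>
  by_cases hf : f = 0
  · exact hf ▸ zero_mem _
  obtain ⟨a, ha⟩ := exists_isLeadingExponent hf
  obtain ⟨c, hc⟩ := exists_isLeadingExponent hd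
  have hu : ∀ n : ℕ, c + n • a ∈ AddSubmonoid.closure s := fun n => h n _ (hc.mul_pow ha n).1
  have haS : a ∈ AddSubmonoid.closure s := by
    obtain ⟨i, j, hij, hmem⟩ := AddSubmonoid.exists_lt_sub_mem_of_finite hs _ hu
    refine hS a ?_ (j - i) (by omega) ?_
    · have : a = (c + 1 • a) - (c + 0 • a) := by simp
      rw [this]
      exact sub_mem (AddSubgroup.subset_closure (hu 1)) (AddSubgroup.subset_closure (hu 0))
    · convert hmem using 1
      rw [add_sub_add_left_eq_sub, eq_sub_iff_add_eq, ← add_nsmul, Nat.sub_add_cancel hij.le]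
  set t := single a (f.coeff a)
  have htS : t ∈ monomialSubalgebra k (AddSubmonoid.closure s) :=
    (single_mem_monomialSubalgebra ha.1).2 haS
  have herase : f.erase a + t = f := AddMonoidAlgebra.erase_add_single a f
  have hmem : f.erase a ∈ monomialSubalgebra k (AddSubmonoid.closure s) := by
    refine ih _ ?_ (f.erase a) ?_ rfl
    · rw [← hn, AddMonoidAlgebra.coeff_erase, Finsupp.support_erase]
      exact Finset.card_erase_lt_of_mem (Finsupp.mem_support_iff.2 ha.1)
    · intro n
      rw [eq_sub_of_add_eq herase, sub_eq_add_neg, add_pow, Finset.mul_sum]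
      refine sum_mem fun i _ => ?_
      rw [← mul_assoc, ← mul_assoc]
      exact mul_mem (mul_mem (h i) (pow_mem (neg_mem htS) _)) (natCast_mem _ _)
  exact herase ▸ add_mem hmem htS

end AddMonoidAlgebra

/-! ### Integral closedness versus normality of the exponent monoid. -/

namespace AddMonoidAlgebra

variable {k σ : Type*} [Field k]

/-- The inclusion of the polynomial ring into the Laurent polynomial ring. -/
noncomputable def ofMvPolynomial (k σ : Type*) [Field k] :
    MvPolynomial σ k →+* AddMonoidAlgebra k (σ →₀ ℤ) :=
  AddMonoidAlgebra.mapDomainRingHom k (Finsupp.mapRange.addMonoidHom (Nat.castAddMonoidHom ℤ))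

theorem ofMvPolynomial_monomial (s : σ →₀ ℕ) (r : k) :
    ofMvPolynomial k σ (MvPolynomial.monomial s r) =
      single (Finsupp.mapRange.addMonoidHom (Nat.castAddMonoidHom ℤ) s) r := by
  exact AddMonoidAlgebra.mapDomain_single

theorem ofMvPolynomial_injective : Function.Injective (ofMvPolynomial k σ) := by
  refine AddMonoidAlgebra.mapDomain_injective ?_
  exact Finsupp.mapRange_injective _ (by simp) Nat.cast_injective

/-- The Laurent ring is the localization of the polynomial ring, which is integrally closed, at the
monomials. -/
theorem isIntegrallyClosed_finsupp_int : IsIntegrallyClosed (AddMonoidAlgebra k (σ →₀ ℤ)) := by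
  classical
  let _ : Algebra (MvPolynomial σ k) (AddMonoidAlgebra k (σ →₀ ℤ)) := (ofMvPolynomial k σ).toAlgebra
  let T : Submonoid (MvPolynomial σ k) :=
    { carrier := Set.range fun s => MvPolynomial.monomial s 1
      one_mem' := ⟨0, rfl⟩
      mul_mem' := by
        rintro _ _ ⟨s, rfl⟩ ⟨t, rfl⟩
        exact ⟨s + t, by simp [MvPolynomial.monomial_mul]⟩ }
  have hT : T ≤ nonZeroDivisors (MvPolynomial σ k) := by
    rintro _ ⟨s, rfl⟩
    exact mem_nonZeroDivisors_of_ne_zero (by simp)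
  have hsurj : ∀ f : AddMonoidAlgebra k (σ →₀ ℤ), ∃ (s : σ →₀ ℕ) (p : MvPolynomial σ k),
      f * ofMvPolynomial k σ (MvPolynomial.monomial s 1) = ofMvPolynomial k σ p := by
    intro f
    induction f using AddMonoidAlgebra.induction_linear with
    | zero => exact ⟨0, 0, by simp⟩
    | add f g hf hg =>
      obtain ⟨s, p, hp⟩ := hf
      obtain ⟨t, q, hq⟩ := hg
      refine ⟨s + t, p * MvPolynomial.monomial t 1 + q * MvPolynomial.monomial s 1, ?_⟩
      rw [map_add, map_mul, map_mul, ← hp, ← hq, ← one_mul (1 : k), ← MvPolynomial.monomial_mul,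
        map_mul, one_mul]
      ring
    | single a r =>
      -- The negative part of the exponent clears the denominator and leaves the positive part.
      refine ⟨a.mapRange (fun z => (-z).toNat) (by simp),
        MvPolynomial.monomial (a.mapRange Int.toNat (by simp)) r, ?_⟩
      rw [ofMvPolynomial_monomial, ofMvPolynomial_monomial, AddMonoidAlgebra.single_mul_single,
        mul_one]
      congr 1
      ext v
      simp
      omega
  have : IsLocalization T (AddMonoidAlgebra k (σ →₀ ℤ)) :=
    { map_units := by
        rintro ⟨_, s, rfl⟩
        change IsUnit (ofMvPolynomial k σ (MvPolynomial.monomial s 1))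
        rw [ofMvPolynomial_monomial]
        refine IsUnit.of_mul_eq_one (single (-(Finsupp.mapRange.addMonoidHom
          (Nat.castAddMonoidHom ℤ) s)) 1) ?_
        rw [AddMonoidAlgebra.single_mul_single, add_neg_cancel, one_mul, AddMonoidAlgebra.one_def]
      surj := by
        intro f
        obtain ⟨s, p, h⟩ := hsurj f
        exact ⟨(p, ⟨_, s, rfl⟩), h⟩
      exists_of_eq := by
        intro x y h
        exact ⟨1, by rw [ofMvPolynomial_injective h]⟩ }
  exact isIntegrallyClosed_of_isLocalization _ T hT

/-- For a = b - c with m • a in S, the m-th power of x^c divides that of x^b. In an integrally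
closed domain x^c then divides x^b, and the quotient can only be x^a. -/
theorem isNormal_of_isIntegrallyClosed {M : Type*} [AddCommGroup M] {S : AddSubmonoid M}
    [IsDomain (monomialSubalgebra k S)] [IsIntegrallyClosed (monomialSubalgebra k S)] :
    S.IsNormal := by
  intro a ha m hm hma
  obtain ⟨b, hb, c, hc, rfl⟩ := AddSubmonoid.exists_sub_of_mem_closure ha
  let x (a : M) (ha : a ∈ S) : monomialSubalgebra k S :=
    ⟨single a 1, (single_mem_monomialSubalgebra one_ne_zero).2 ha⟩
  have hdvd : x c hc ^ m ∣ x b hb ^ m := by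
    refine ⟨x _ hma, Subtype.ext ?_⟩
    change single b (1 : k) ^ m = single c (1 : k) ^ m * single (m • (b - c)) 1
    simp [AddMonoidAlgebra.single_pow, AddMonoidAlgebra.single_mul_single, ← nsmul_add]
  obtain ⟨g, hg⟩ := (IsIntegrallyClosed.pow_dvd_pow_iff hm).1 hdvd
  have hg' : single b (1 : k) = single c 1 * (g : AddMonoidAlgebra k M) := congrArg Subtype.val hg
  have : (g : AddMonoidAlgebra k M) = single (b - c) 1 := by
    calc (g : AddMonoidAlgebra k M) = single (-c) 1 * (single c 1 * (g : AddMonoidAlgebra k M)) := by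
          rw [← mul_assoc, AddMonoidAlgebra.single_mul_single, neg_add_cancel, one_mul,
            ← AddMonoidAlgebra.one_def, one_mul]
      _ = single (b - c) 1 := by
          rw [← hg', AddMonoidAlgebra.single_mul_single, one_mul, neg_add_eq_sub]
  exact (single_mem_monomialSubalgebra one_ne_zero).1 (this ▸ g.2)

/-- An integral fraction is a Laurent polynomial f, the Laurent ring being integrally closed. It is
also almost integral: some d ≠ 0 has all d * f ^ n in the subring, which forces f into it. -/
theorem isIntegrallyClosed_of_isNormal {s : Set (σ →₀ ℤ)} (hs : s.Finite)
    (hS : (AddSubmonoid.closure s).IsNormal) :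
    IsIntegrallyClosed (monomialSubalgebra k (AddSubmonoid.closure s)) := by
  set R := monomialSubalgebra k (AddSubmonoid.closure s)
  let L := AddMonoidAlgebra k (σ →₀ ℤ)
  have hL : IsIntegrallyClosed L := isIntegrallyClosed_finsupp_int
  rw [isIntegrallyClosed_iff (FractionRing R)]
  intro x hx
  have hinj : Function.Injective (algebraMap R (FractionRing L)) :=
    (IsFractionRing.injective L (FractionRing L)).comp Subtype.val_injective
  let φ : FractionRing R →ₐ[R] FractionRing L := IsFractionRing.liftAlgHom (g := Algebra.ofId R _) hinj
  have hint : IsIntegral L (φ x) := (hx.map φ).tower_top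
  obtain ⟨f, hf⟩ := (isIntegrallyClosed_iff (FractionRing L)).1 hL hint
  obtain ⟨d, hd, hdn⟩ := hx.isAlmostIntegral
  have hfR : f ∈ R := by
    -- Leading exponents are taken lexicographically, for an arbitrary linear order of the
    -- variables.
    obtain ⟨_⟩ : Nonempty (LinearOrder σ) := by
      classical exact ⟨linearOrderOfSTO WellOrderingRel⟩
    refine @mem_monomialSubalgebra_of_mul_pow_mem k (σ →₀ ℤ) _ _
      (inferInstanceAs (LinearOrder (Lex (σ →₀ ℤ))))
      (inferInstanceAs (IsOrderedCancelAddMonoid (Lex (σ →₀ ℤ)))) s hs hS f d ?_ ?_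
    · simpa using nonZeroDivisors.ne_zero hd
    · intro n
      obtain ⟨r, hr⟩ := hdn n
      have := congrArg φ hr
      rw [Algebra.smul_def, AlgHom.commutes, map_mul, AlgHom.commutes, map_pow, ← hf] at this
      have h2 : (r : L) = d * f ^ n := by
        apply IsFractionRing.injective L (FractionRing L)
        rw [map_mul, map_pow]
        exact this
      rw [← h2]
      exact r.2
  refine ⟨⟨f, hfR⟩, ?_⟩
  apply φ.toRingHom.injective
  change φ _ = φ _
  rw [AlgHom.commutes, ← hf]
  rfl

end AddMonoidAlgebra

/-! ### Walks, their edge sums, and odd closed walks. -/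

namespace SignedGraph

variable {V : Type*} {G : SignedGraph V}

theorem rho_mk (ε : ℤˣ) (i j : V) :
    rho (ε, s(i, j)) = Finsupp.single i (ε : ℤ) + Finsupp.single j (ε : ℤ) := by
  simp [rho]

/-- The submonoid generated by the exponent vectors of the edges. -/
noncomputable def edgeMonoid (G : SignedGraph V) : AddSubmonoid (V →₀ ℤ) :=
  AddSubmonoid.closure (rho '' G.edges)

theorem single_add_single_mem {ε : ℤˣ} {i j : V} (h : (ε, s(i, j)) ∈ G.edges) :
    Finsupp.single i (ε : ℤ) + Finsupp.single j (ε : ℤ) ∈ G.edgeMonoid :=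
  rho_mk ε i j ▸ AddSubmonoid.subset_closure ⟨_, h, rfl⟩

namespace Walk

/-- Concatenation of walks. -/
def append {u v w : V} : G.Walk u v → G.Walk v w → G.Walk u w
  | nil _, q => q
  | cons ε h p, q => cons ε h (p.append q)

@[simp]
theorem nil_append {u v : V} (q : G.Walk u v) : (nil u).append q = q := rfl

@[simp]
theorem cons_append {u v w x : V} (ε : ℤˣ) (h : (ε, s(u, v)) ∈ G.edges) (p : G.Walk v w)
    (q : G.Walk w x) : (cons ε h p).append q = cons ε h (p.append q) := rfl

@[simp]
theorem length_nil (u : V) : (nil u : G.Walk u u).length = 0 := rfl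

@[simp]
theorem length_cons {u v w : V} (ε : ℤˣ) (h : (ε, s(u, v)) ∈ G.edges) (p : G.Walk v w) :
    (cons ε h p).length = p.length + 1 := rfl

@[simp]
theorem support_nil (u : V) : (nil u : G.Walk u u).support = [u] := rfl

@[simp]
theorem support_cons {u v w : V} (ε : ℤˣ) (h : (ε, s(u, v)) ∈ G.edges) (p : G.Walk v w) :
    (cons ε h p).support = u :: p.support := rfl

@[simp]
theorem edgeList_nil (u : V) : (nil u : G.Walk u u).edgeList = [] := rfl

@[simp]
theorem edgeList_cons {u v w : V} (ε : ℤˣ) (h : (ε, s(u, v)) ∈ G.edges) (p : G.Walk v w) :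
    (cons ε h p).edgeList = (ε, s(u, v)) :: p.edgeList := rfl

@[simp]
theorem length_append {u v w : V} (p : G.Walk u v) (q : G.Walk v w) :
    (p.append q).length = p.length + q.length := by
  induction p with
  | nil => simp
  | cons ε h p ih => simp [ih]; omega

@[simp]
theorem start_mem_support {u v : V} (p : G.Walk u v) : u ∈ p.support := by
  cases p <;> simp

@[simp]
theorem end_mem_support {u v : V} (p : G.Walk u v) : v ∈ p.support := by
  induction p with
  | nil => simp
  | cons ε h p ih => simp [ih]

theorem mem_support_append {u v w x : V} (p : G.Walk u v) (q : G.Walk v w) :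
    x ∈ (p.append q).support ↔ x ∈ p.support ∨ x ∈ q.support := by
  induction p with
  | nil u =>
    simp only [nil_append, support_nil, List.mem_singleton]
    exact ⟨Or.inr, fun h => h.elim (fun h => h ▸ q.start_mem_support) id⟩
  | cons ε h p ih => simp [ih, or_assoc]

theorem exists_append_of_mem_support {u v x : V} (p : G.Walk u v) (hx : x ∈ p.support) :
    ∃ (q : G.Walk u x) (r : G.Walk x v), p = q.append r := by
  induction p with
  | nil u =>
    obtain rfl : x = u := by simpa using hx
    exact ⟨nil x, nil x, rfl⟩
  | @cons u v w ε h p ih =>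
    rcases List.mem_cons.1 hx with rfl | hx
    · exact ⟨nil x, cons ε h p, rfl⟩
    · obtain ⟨q, r, rfl⟩ := ih hx
      exact ⟨cons ε h q, r, rfl⟩

/-- The sum of the exponent vectors of the edges of a walk. -/
noncomputable def rhoSum {u v : V} (p : G.Walk u v) : V →₀ ℤ := (p.edgeList.map rho).sum

@[simp]
theorem rhoSum_nil (u : V) : (nil u : G.Walk u u).rhoSum = 0 := rfl

@[simp]
theorem rhoSum_cons {u v w : V} (ε : ℤˣ) (h : (ε, s(u, v)) ∈ G.edges) (p : G.Walk v w) :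
    (cons ε h p).rhoSum = Finsupp.single u (ε : ℤ) + Finsupp.single v (ε : ℤ) + p.rhoSum := by
  simp [rhoSum, rho_mk]

@[simp]
theorem rhoSum_append {u v w : V} (p : G.Walk u v) (q : G.Walk v w) :
    (p.append q).rhoSum = p.rhoSum + q.rhoSum := by
  induction p with
  | nil => simp
  | cons ε h p ih => simp [ih, add_assoc]

theorem rhoSum_mem {u v : V} (p : G.Walk u v) : p.rhoSum ∈ G.edgeMonoid := by
  induction p with
  | nil => exact zero_mem _
  | cons ε h p ih =>
    rw [rhoSum_cons]
    exact add_mem (single_add_single_mem h) ih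

theorem rhoSum_apply_of_notMem {u v x : V} (p : G.Walk u v) (hx : x ∉ p.support) :
    p.rhoSum x = 0 := by
  classical
  induction p with
  | nil => rfl
  | cons ε h p ih =>
    simp only [support_cons, List.mem_cons, not_or] at hx
    have hv : x ≠ _ := fun h => hx.2 (h ▸ p.start_mem_support)
    simp [ih hx.2, Ne.symm hx.1, hv.symm]

/-- Along a walk, the edge vectors sum to twice an element of the edge monoid up to
prescribed contributions of the ends. -/
theorem exists_rhoSum_eq {u v : V} (p : G.Walk u v) (δ : ℤˣ) :
    ∃ s ∈ G.edgeMonoid, p.rhoSum = 2 • s + Finsupp.single u (δ : ℤ) -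
      Finsupp.single v (((-1) ^ p.length * δ : ℤˣ) : ℤ) := by
  induction p generalizing δ with
  | nil => exact ⟨0, zero_mem _, by simp⟩
  | @cons u v w ε h p ih =>
    obtain ⟨s, hs, hp⟩ := ih (-δ)
    have hsign : (-1) ^ p.length * -δ = (-1) ^ (p.length + 1) * δ := by
      rw [pow_succ]; simp
    rw [hsign] at hp
    -- An edge of sign δ cancels the end contribution of the rest at v; an edge of sign -δ is
    -- counted once more in s, which corrects the sign at u.
    by_cases hε : ε = δ
    · subst hε
      refine ⟨s, hs, ?_⟩
      rw [rhoSum_cons, hp, length_cons]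
      simp only [Units.val_neg, Finsupp.single_neg]
      abel
    · obtain rfl : ε = -δ := Int.units_ne_iff_eq_neg.1 hε
      refine ⟨Finsupp.single u ((-δ : ℤˣ) : ℤ) + Finsupp.single v ((-δ : ℤˣ) : ℤ) + s,
        add_mem (single_add_single_mem h) hs, ?_⟩
      rw [rhoSum_cons, hp, length_cons]
      simp only [Units.val_neg, Finsupp.single_neg]
      abel

/-- Rotate the walk to start at x. Its length being odd, the two end contributions in
`exists_rhoSum_eq` add up to 2δ at x instead of cancelling, and the equation can be halved. The free
choice of δ is what later allows two half-sums to be matched. -/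
theorem half_rhoSum_sub_single_mem {u x : V} {p : G.Walk u u} (hp : Odd p.length) {w : V →₀ ℤ}
    (hw : 2 • w = p.rhoSum) (hx : x ∈ p.support) (δ : ℤˣ) :
    w - Finsupp.single x (δ : ℤ) ∈ G.edgeMonoid := by
  obtain ⟨q, r, rfl⟩ := p.exists_append_of_mem_support hx
  obtain ⟨s, hs, h⟩ := (r.append q).exists_rhoSum_eq δ
  have hlen : Odd (r.append q).length := by
    rw [length_append] at hp ⊢
    rwa [add_comm]
  have : w - Finsupp.single x (δ : ℤ) = s := by
    apply smul_right_injective _ (two_ne_zero (α := ℕ))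
    rw [rhoSum_append, add_comm, ← rhoSum_append, h, hlen.neg_one_pow] at hw
    simp only [smul_sub, hw, neg_mul, one_mul, Units.val_neg, Finsupp.single_neg]
    abel
  exact this ▸ hs

theorem exists_half_rhoSum {u : V} {p : G.Walk u u} (hp : Odd p.length) :
    ∃ w : V →₀ ℤ, 2 • w = p.rhoSum := by
  obtain ⟨s, -, h⟩ := p.exists_rhoSum_eq 1
  refine ⟨s + Finsupp.single u 1, ?_⟩
  rw [h, hp.neg_one_pow]
  simp only [neg_mul, one_mul, Units.val_neg, Units.val_one, Finsupp.single_neg]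
  abel

theorem half_rhoSum_apply_of_notMem {u x : V} {p : G.Walk u u} {w : V →₀ ℤ}
    (hw : 2 • w = p.rhoSum) (hx : x ∉ p.support) : w x = 0 := by
  have := DFunLike.congr_fun hw x
  rw [p.rhoSum_apply_of_notMem hx] at this
  simpa using this

theorem mem_support_of_mem_edgeList {u v a b : V} {ε : ℤˣ} {p : G.Walk u v}
    (h : (ε, s(a, b)) ∈ p.edgeList) : a ∈ p.support := by
  induction p with
  | nil => simp at h
  | cons ε' h' p ih =>
    rw [edgeList_cons, List.mem_cons] at h
    rcases h with h | h
    · rcases Sym2.eq_iff.1 (Prod.ext_iff.1 h).2 with ⟨rfl, -⟩ | ⟨rfl, -⟩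
      · simp
      · simp
    · simp [ih h]

theorem edgeList_nodup_of_support_nodup {u v : V} {p : G.Walk u v} (h : p.support.Nodup) :
    p.edgeList.Nodup := by
  induction p with
  | nil => simp
  | cons ε h' p ih =>
    rw [support_cons, List.nodup_cons] at h
    rw [edgeList_cons, List.nodup_cons]
    exact ⟨fun hmem => h.1 (mem_support_of_mem_edgeList hmem), ih h.2⟩

theorem eq_nil_of_support_nodup {u : V} {p : G.Walk u u} (h : p.support.Nodup) : p = nil u := by
  cases p with
  | nil => rfl
  | cons ε h' p =>
    rw [support_cons, List.nodup_cons] at h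
    exact absurd p.end_mem_support h.1

theorem isCycle_of_odd {u : V} {p : G.Walk u u} (hp : Odd p.length) (h : p.support.tail.Nodup) :
    p.IsCycle := by
  refine ⟨hp.pos, ?_, h⟩
  match p, hp, h with
  | nil _, hp, _ => simp at hp
  | cons ε h' (nil _), _, _ => simp
  | cons (v := v) ε h' (cons (v := x) ε' h'' q), hp, h =>
    simp only [support_cons, List.tail_cons, List.nodup_cons] at h
    rw [edgeList_cons, List.nodup_cons]
    refine ⟨fun hmem => ?_, edgeList_nodup_of_support_nodup (by simpa using h)⟩
    rw [edgeList_cons, List.mem_cons] at hmem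
    rcases hmem with hmem | hmem
    -- If the second edge repeats the first, the walk is back at its start after two steps and must
    -- stop there, against odd length.
    · have hux : x = u := by
        rcases Sym2.eq_iff.1 (Prod.ext_iff.1 hmem).2 with ⟨rfl, -⟩ | ⟨rfl, -⟩
        · exact absurd q.end_mem_support h.1
        · rfl
      subst hux
      rw [eq_nil_of_support_nodup h.2] at hp
      simp [Nat.odd_iff] at hp
    · rw [Sym2.eq_swap] at hmem
      exact h.1 (mem_support_of_mem_edgeList hmem)

theorem exists_closed_of_not_support_nodup {u v : V} (p : G.Walk u v) (h : ¬ p.support.Nodup) :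
    ∃ (x : V) (q : G.Walk u x) (c : G.Walk x x) (r : G.Walk x v),
      0 < c.length ∧ p = q.append (c.append r) := by
  induction p with
  | nil => simp at h
  | @cons u v w ε h' p ih =>
    by_cases hu : u ∈ p.support
    · obtain ⟨a, b, rfl⟩ := p.exists_append_of_mem_support hu
      exact ⟨u, nil u, cons ε h' a, b, by simp, rfl⟩
    · rw [support_cons, List.nodup_cons, not_and] at h
      obtain ⟨x, q, c, r, hc, rfl⟩ := ih (h hu)
      exact ⟨x, cons ε h' q, c, r, hc, rfl⟩

/-- At a repeated vertex a closed walk splits into two shorter closed walks, one of which is odd. -/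
theorem exists_isOddCycle {u : V} (p : G.Walk u u) (hp : Odd p.length) :
    ∃ (v : V) (C : G.Walk v v), C.IsOddCycle ∧ ∀ x ∈ C.support, x ∈ p.support := by
  induction hn : p.length using Nat.strong_induction_on generalizing u with
  | _ n ih =>
  by_cases hnd : p.support.tail.Nodup
  · exact ⟨u, p, ⟨isCycle_of_odd hp hnd, hp⟩, fun _ h => h⟩
  · cases p with
    | nil => simp at hnd
    | cons ε h p =>
      obtain ⟨x, q, c, r, hc, rfl⟩ := p.exists_closed_of_not_support_nodup hnd
      simp only [length_cons, length_append] at hn hp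
      by_cases hodd : Odd c.length
      · obtain ⟨v, C, hC, hsub⟩ := ih _ (by omega) c hodd rfl
        refine ⟨v, C, hC, fun y hy => ?_⟩
        simp [mem_support_append, hsub y hy]
      · have hlen : (cons ε h (q.append r)).length < n := by simp; omega
        obtain ⟨v, C, hC, hsub⟩ := ih _ hlen (cons ε h (q.append r)) (by
          simp only [length_cons, length_append, Nat.odd_iff] at hp hodd ⊢
          omega) rfl
        refine ⟨v, C, hC, fun y hy => ?_⟩
        have := hsub y hy
        simp only [support_cons, List.mem_cons, mem_support_append] at this ⊢
        tauto

end Walk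

/-! ### Components and alternating walks. -/

theorem SameComponent.refl (u : V) : G.SameComponent u u := ⟨.nil u⟩

theorem SameComponent.trans {u v w : V} : G.SameComponent u v → G.SameComponent v w →
    G.SameComponent u w := fun ⟨p⟩ ⟨q⟩ => ⟨p.append q⟩

theorem sameComponent_of_mem_edges {ε : ℤˣ} {u v : V} (h : (ε, s(u, v)) ∈ G.edges) :
    G.SameComponent u v := ⟨.cons ε h (.nil v)⟩

theorem SameComponent.symm {u v : V} (h : G.SameComponent u v) : G.SameComponent v u := by
  obtain ⟨p⟩ := h
  induction p with
  | nil u => exact .refl u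
  | cons ε h p ih => exact ih.trans (sameComponent_of_mem_edges (Sym2.eq_swap ▸ h))

theorem Walk.sameComponent_of_mem_support {u v x : V} (p : G.Walk u v) (hx : x ∈ p.support) :
    G.SameComponent u x :=
  let ⟨q, _, _⟩ := p.exists_append_of_mem_support hx
  ⟨q⟩

/-- `G.Alt ε i δ j` means that there is a sign-alternating walk of positive length from `i` to `j`
whose first edge has sign `ε` and whose last edge has sign `δ`. -/
inductive Alt (G : SignedGraph V) : ℤˣ → V → ℤˣ → V → Prop
  | edge {ε : ℤˣ} {i j : V} (h : (ε, s(i, j)) ∈ G.edges) : Alt G ε i ε j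
  | cons {ε δ : ℤˣ} {i j l : V} (h : (ε, s(i, j)) ∈ G.edges) (p : Alt G (-ε) j δ l) : Alt G ε i δ l

theorem Alt.snoc {ε δ : ℤˣ} {i j l : V} (p : G.Alt ε i (-δ) j) (h : (δ, s(j, l)) ∈ G.edges) :
    G.Alt ε i δ l := by
  generalize hγ : -δ = γ at p
  induction p with
  | edge h' => exact .cons h' (by rw [← hγ, neg_neg]; exact .edge h)
  | cons h' p ih => exact .cons h' (ih h hγ)

/-- Contributions at inner vertices cancel, so only the ends survive. The end signs also determine
the parity of the length. -/
theorem Alt.exists_walk {ε δ : ℤˣ} {i j : V} (h : G.Alt ε i δ j) :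
    ∃ p : G.Walk i j, p.IsAlternating ∧ (∃ e ∈ p.edgeList.head?, e.1 = ε) ∧
      p.rhoSum = Finsupp.single i (ε : ℤ) + Finsupp.single j (δ : ℤ) ∧
      (-1) ^ p.length = -(ε * δ) := by
  induction h with
  | @edge ε i j h =>
    exact ⟨.cons ε h (.nil j), by simp [Walk.IsAlternating], by simp, by simp,
      by simp [Int.units_mul_self]⟩
  | @cons ε δ i j l h _ ih =>
    obtain ⟨p, halt, ⟨e, he, heε⟩, hsum, hlen⟩ := ih
    refine ⟨.cons ε h p, ?_, by simp, ?_, ?_⟩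
    · rw [Walk.IsAlternating, Walk.edgeList_cons, List.isChain_cons]
      refine ⟨fun f hf => ?_, halt⟩
      rw [Option.mem_unique hf he, heε]
      exact Int.units_ne_iff_eq_neg.2 (neg_neg ε).symm
    · rw [Walk.rhoSum_cons, hsum]
      simp only [Units.val_neg, Finsupp.single_neg]
      abel
    · rw [Walk.length_cons, pow_succ, hlen]
      simp

theorem Walk.IsAlternating.alt {i j : V} {p : G.Walk i j} (hp : p.IsAlternating)
    {e : ℤˣ × Sym2 V} (he : e ∈ p.edgeList.head?) : ∃ δ, G.Alt e.1 i δ j := by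
  induction p generalizing e with
  | nil => simp at he
  | cons ε h p ih =>
    obtain rfl : (ε, s(_, _)) = e := by simpa using he
    rw [Walk.IsAlternating, Walk.edgeList_cons, List.isChain_cons] at hp
    cases p with
    | nil => exact ⟨ε, .edge h⟩
    | cons ε' h' p =>
      obtain ⟨δ, hδ⟩ := ih hp.2 (e := (ε', s(_, _))) rfl
      have : ε ≠ ε' := hp.1 _ rfl
      obtain rfl : ε' = -ε := by rw [Int.units_ne_iff_eq_neg.1 this, neg_neg]
      exact ⟨δ, .cons h hδ⟩

theorem Alt.single_add_single_mem {ε δ : ℤˣ} {i j : V} (h : G.Alt ε i δ j) :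
    Finsupp.single i (ε : ℤ) + Finsupp.single j (δ : ℤ) ∈ G.edgeMonoid := by
  obtain ⟨p, -, -, hp, -⟩ := h.exists_walk
  exact hp ▸ p.rhoSum_mem

/-- At a common vertex x, write w + z = (w - e_x) + (z + e_x). Otherwise take εe_i from w and δe_j
from z, and give both back as the edge sum of the alternating walk. -/
theorem OddCycleCondition.half_rhoSum_add_mem (hG : G.OddCycleCondition) {u v : V}
    {p : G.Walk u u} {q : G.Walk v v} (hp : Odd p.length) (hq : Odd q.length) {w z : V →₀ ℤ}
    (hw : 2 • w = p.rhoSum) (hz : 2 • z = q.rhoSum) (huv : G.SameComponent u v) :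
    w + z ∈ G.edgeMonoid := by
  obtain ⟨u', C, hC, hCp⟩ := p.exists_isOddCycle hp
  obtain ⟨v', D, hD, hDq⟩ := q.exists_isOddCycle hq
  have common : ∀ x ∈ p.support, x ∈ q.support → w + z ∈ G.edgeMonoid := by
    intro x hx hx'
    have := add_mem (Walk.half_rhoSum_sub_single_mem hp hw hx 1)
      (Walk.half_rhoSum_sub_single_mem hq hz hx' (-1))
    convert this using 1
    simp only [Units.val_neg, Finsupp.single_neg]
    abel
  rcases hG u' v' C D hC hD with h | ⟨x, hx, hx'⟩ | ⟨i, hi, j, hj, P, hP⟩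
  · refine absurd ?_ h
    exact ((p.sameComponent_of_mem_support (hCp _ C.start_mem_support)).symm.trans huv).trans
      (q.sameComponent_of_mem_support (hDq _ D.start_mem_support))
  · exact common x (hCp x hx) (hDq x hx')
  · cases P with
    | nil => exact common i (hCp i hi) (hDq i hj)
    | cons ε h P =>
      obtain ⟨δ, hδ⟩ := hP.alt (e := (ε, s(_, _))) rfl
      have := add_mem (add_mem (Walk.half_rhoSum_sub_single_mem hp hw (hCp i hi) ε)
        (Walk.half_rhoSum_sub_single_mem hq hz (hDq j hj) δ)) hδ.single_add_single_mem
      convert this using 1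
      dsimp only
      abel

end SignedGraph

/-! ### Potentials and the matching by alternating walks. -/

namespace SignedGraph

variable {V : Type*} {G : SignedGraph V}

/-- The signed vertices reached by a sign-alternating walk of positive length whose initial vertex
and sign lie in `X`. -/
def reach (G : SignedGraph V) (X : Set (ℤˣ × V)) : Set (ℤˣ × V) :=
  {q | ∃ p ∈ X, G.Alt p.1 p.2 q.1 q.2}

/-- The signed vertices from which an alternating walk starting in `X` can be continued. -/
def departing (G : SignedGraph V) (X : Set (ℤˣ × V)) : Set (ℤˣ × V) :=
  {q | q ∈ X ∨ (-q.1, q.2) ∈ G.reach X}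

theorem neg_mem_departing {X : Set (ℤˣ × V)} {ε : ℤˣ} {i j : V} (h : (ε, s(i, j)) ∈ G.edges)
    (hi : (ε, i) ∈ G.departing X) : (-ε, j) ∈ G.departing X := by
  right
  rcases hi with hi | ⟨p, hp, hi⟩
  · refine ⟨_, hi, ?_⟩
    simp only [neg_neg]
    exact .edge h
  · refine ⟨p, hp, ?_⟩
    simp only [neg_neg]
    exact hi.snoc h

open Classical in
/-- The potential of a vertex with respect to a set of signed vertices. -/
noncomputable def potential (D : Set (ℤˣ × V)) (v : V) : ℤ :=
  (if (1, v) ∈ D then 1 else 0) - (if (-1, v) ∈ D then 1 else 0)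

open Classical in
/-- The indicator function of the vertices both of whose signed versions lie in `D`. -/
noncomputable def bothSigns (D : Set (ℤˣ × V)) (v : V) : ℤ :=
  if (1, v) ∈ D ∧ (-1, v) ∈ D then 1 else 0

/-- It suffices to look at one edge ε ij. By `neg_mem_departing`, a positive contribution at either
end is offset by a negative one at the other. In the case of equality both memberships are
equivalences, so i has both signs exactly when j does. A sum of nonpositive terms vanishes only
termwise, which carries the parity along. -/
theorem potential_nonpos_and_even (X : Set (ℤˣ × V)) {x : V →₀ ℤ} (hx : x ∈ G.edgeMonoid) :
    Finsupp.linearCombination ℤ (potential (G.departing X)) x ≤ 0 ∧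
      (Finsupp.linearCombination ℤ (potential (G.departing X)) x = 0 →
        Even (Finsupp.linearCombination ℤ (bothSigns (G.departing X)) x)) := by
  induction hx using AddSubmonoid.closure_induction with
  | zero => simp
  | add x y _ _ hx hy =>
    rw [map_add, map_add]
    refine ⟨add_nonpos hx.1 hy.1, fun h => ?_⟩
    have h1 := hx.1
    have h2 := hy.1
    exact (hx.2 (by omega)).add (hy.2 (by omega))
  | mem x hx =>
    obtain ⟨⟨ε, e⟩, he, rfl⟩ := hx
    induction e using Sym2.ind with
    | _ i j =>
    have h1 := neg_mem_departing (X := X) he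
    have h2 := neg_mem_departing (X := X) (Sym2.eq_swap ▸ he)
    rw [rho_mk]
    simp only [map_add, Finsupp.linearCombination_single, potential, bothSigns, smul_eq_mul]
    rcases Int.units_eq_one_or ε with rfl | rfl
    · simp only [Units.val_one, one_mul]
      constructor
      · split_ifs <;> simp_all
      · split_ifs <;> simp_all
    · simp only [neg_neg, Units.val_neg, Units.val_one, neg_mul, one_mul] at h1 h2 ⊢
      constructor
      · split_ifs <;> simp_all
      · split_ifs <;> simp_all

/-- The sign of an integer, `0` counting as positive. -/
def unitSign (z : ℤ) : ℤˣ := if 0 ≤ z then 1 else -1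

theorem unitSign_mul_natAbs (z : ℤ) : (unitSign z : ℤ) * z.natAbs = z := by
  rw [unitSign]
  split_ifs with h
  · simp [abs_of_nonneg h]
  · simp [abs_of_neg (not_le.1 h)]

theorem sum_sigma_fin_single [Fintype V] (a : V →₀ ℤ) :
    ∑ p : Σ v, Fin (a v).natAbs, Finsupp.single p.1 (unitSign (a p.1) : ℤ) = a := by
  rw [Fintype.sum_sigma]
  simp only [Finset.sum_const, Finset.card_univ, Fintype.card_fin, Finsupp.smul_single,
    nsmul_eq_mul, mul_comm _ (unitSign _ : ℤ), unitSign_mul_natAbs]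
  exact Finsupp.univ_sum_single a

theorem natAbs_ite_sub_le {z : ℤ} (hz : 0 ≤ z) {A B P Q : Prop} [Decidable A] [Decidable B]
    [Decidable P] [Decidable Q] (hP : A → P) (hQ : Q → B) :
    ((if A then z.natAbs else 0 : ℕ) : ℤ) - ((if B then z.natAbs else 0 : ℕ) : ℤ) ≤
      z * ((if P then 1 else 0) - (if Q then 1 else 0)) := by
  obtain ⟨n, rfl⟩ := Int.eq_ofNat_of_zero_le hz
  split_ifs <;> first | tauto | simp

/-- A vector in the cone of the edge monoid is a sum of signed unit vectors which are permuted in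
such a way that each is joined to its image by an alternating walk. -/
theorem exists_injective_alt [Fintype V] {a : V →₀ ℤ} {m : ℕ} (hm : m ≠ 0)
    (ha : m • a ∈ G.edgeMonoid) :
    ∃ f : (Σ v, Fin (a v).natAbs) → (Σ v, Fin (a v).natAbs), Function.Injective f ∧
      ∀ p, G.Alt (unitSign (a p.1)) p.1 (unitSign (a (f p).1)) (f p).1 := by
  classical
  -- Hall's marriage theorem, a vertex v being represented by |a v| copies.
  refine (Fintype.all_card_le_filter_rel_iff_exists_injective
    fun p q : Σ v, Fin (a v).natAbs => G.Alt (unitSign (a p.1)) p.1 (unitSign (a q.1)) q.1).1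
    fun A => ?_
  set T : Finset V := A.image Sigma.fst with hT
  set X : Set (ℤˣ × V) := {q | q.2 ∈ T ∧ q.1 = unitSign (a q.2)} with hX
  set N : Finset V := {v | (unitSign (a v), v) ∈ G.reach X} with hN
  have hpot : ∑ v, a v * potential (G.departing X) v ≤ 0 := by
    have h := (potential_nonpos_and_even X ha).1
    rw [map_nsmul, Finsupp.linearCombination_apply, Finsupp.sum_fintype _ _ (by simp)] at h
    simp only [smul_eq_mul, nsmul_eq_mul] at h
    exact nonpos_of_mul_nonpos_right h (by positivity)
  have hterm : ∀ v, ((if v ∈ T then (a v).natAbs else 0 : ℕ) : ℤ) -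
      ((if v ∈ N then (a v).natAbs else 0 : ℕ) : ℤ) ≤ a v * potential (G.departing X) v := by
    intro v
    have h1 : v ∈ T → (unitSign (a v), v) ∈ G.departing X := fun h => Or.inl ⟨h, rfl⟩
    -- Since `X` holds vertices only with their own sign, the opposite sign can depart only after
    -- the vertex has been reached with its own.
    have h2 : (-unitSign (a v), v) ∈ G.departing X → v ∈ N := by
      rintro (⟨-, h⟩ | h)
      · exact absurd h.symm (Int.units_ne_iff_eq_neg.2 (neg_neg _).symm)
      · simpa [hN] using h
    rw [potential]
    by_cases hv : 0 ≤ a v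
    · rw [unitSign, if_pos hv] at h1 h2
      exact natAbs_ite_sub_le hv h1 h2
    · rw [unitSign, if_neg hv] at h1 h2
      have := natAbs_ite_sub_le (z := -a v) (by omega) h1 (neg_neg (1 : ℤˣ) ▸ h2)
      rw [Int.natAbs_neg, neg_mul, ← mul_neg, neg_sub] at this
      exact this
  have hle : ∑ v ∈ T, (a v).natAbs ≤ ∑ v ∈ N, (a v).natAbs := by
    have := (Finset.sum_le_sum fun v (_ : v ∈ Finset.univ) => hterm v).trans hpot
    rw [Finset.sum_sub_distrib, ← Nat.cast_sum, ← Nat.cast_sum] at this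
    simp only [Finset.sum_ite_mem, Finset.univ_inter] at this
    omega
  calc A.card ≤ (T.sigma fun v => (Finset.univ : Finset (Fin (a v).natAbs))).card := by
        refine Finset.card_le_card fun p hp => ?_
        simpa [hT] using ⟨p.2, hp⟩
    _ ≤ (N.sigma fun v => (Finset.univ : Finset (Fin (a v).natAbs))).card := by
        simpa [Finset.card_sigma] using hle
    _ ≤ _ := by
        refine Finset.card_le_card fun q hq => ?_
        simp only [hN, reach, hX, hT, Finset.mem_sigma, Finset.mem_univ, and_true,
          Finset.mem_filter, true_and, Set.mem_ofPred_eq] at hq ⊢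
        obtain ⟨⟨ε, v⟩, ⟨hv, hε⟩, halt⟩ := hq
        dsimp only at hv hε halt
        subst hε
        obtain ⟨p, hp, rfl⟩ := Finset.mem_image.1 hv
        exact ⟨p, hp, halt⟩

/-- `w` is half the sum of the edge vectors of an odd closed walk at `u`. -/
def IsHalfOddClosed (G : SignedGraph V) (w : V →₀ ℤ) (u : V) : Prop :=
  ∃ p : G.Walk u u, Odd p.length ∧ 2 • w = p.rhoSum

/-! ### Orbits of the matching: even ones and odd ones. -/

section Cyclic

variable {c : ℕ → ℤˣ × V}

theorem exists_walk_of_forall_alt (hc : ∀ n, G.Alt (c n).1 (c n).2 (c (n + 1)).1 (c (n + 1)).2)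
    (n : ℕ) : ∃ p : G.Walk (c 0).2 (c n).2,
      p.rhoSum = ∑ t ∈ Finset.range n, (Finsupp.single (c t).2 ((c t).1 : ℤ) +
        Finsupp.single (c (t + 1)).2 ((c (t + 1)).1 : ℤ)) ∧
      (-1) ^ p.length = (-1) ^ n * ((c 0).1 * (c n).1) := by
  induction n with
  | zero => exact ⟨.nil _, by simp, by simp [Int.units_mul_self]⟩
  | succ n ih =>
    obtain ⟨p, hp, hlen⟩ := ih
    obtain ⟨q, -, -, hq, hlen'⟩ := (hc n).exists_walk
    refine ⟨p.append q, ?_, ?_⟩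
    · rw [Walk.rhoSum_append, hp, hq, Finset.sum_range_succ]
    · rw [Walk.length_append, pow_add, hlen, hlen', pow_succ]
      have := Int.units_mul_self (c n).1
      calc (-1) ^ n * ((c 0).1 * (c n).1) * -((c n).1 * (c (n + 1)).1)
          = (-1) ^ n * -1 * ((c 0).1 * ((c n).1 * (c n).1) * (c (n + 1)).1) := by
            simp only [mul_neg, mul_one, neg_mul, mul_assoc]
        _ = _ := by rw [this, mul_one]

theorem sum_range_two_mul_mem (hc : ∀ n, G.Alt (c n).1 (c n).2 (c (n + 1)).1 (c (n + 1)).2)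
    (r : ℕ) : ∑ t ∈ Finset.range (2 * r), Finsupp.single (c t).2 ((c t).1 : ℤ) ∈ G.edgeMonoid := by
  induction r with
  | zero => simp
  | succ r ih =>
    rw [Nat.mul_succ, Finset.sum_range_succ, Finset.sum_range_succ, add_assoc]
    exact add_mem ih (hc _).single_add_single_mem

/-- The concatenated walk closes up and counts every term twice. Its end signs agree, so its length
has the parity of `L`. -/
theorem isHalfOddClosed_sum_range (hc : ∀ n, G.Alt (c n).1 (c n).2 (c (n + 1)).1 (c (n + 1)).2)
    {L : ℕ} (hL : Odd L) (h0 : c L = c 0) :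
    G.IsHalfOddClosed (∑ t ∈ Finset.range L, Finsupp.single (c t).2 ((c t).1 : ℤ)) (c 0).2 := by
  have hwalk := exists_walk_of_forall_alt hc L
  rw [h0] at hwalk
  obtain ⟨p, hp, hlen⟩ := hwalk
  have hshift : ∑ t ∈ Finset.range L, Finsupp.single (c (t + 1)).2 ((c (t + 1)).1 : ℤ) =
      ∑ t ∈ Finset.range L, Finsupp.single (c t).2 ((c t).1 : ℤ) := by
    have := Finset.sum_range_succ' (fun t => Finsupp.single (c t).2 ((c t).1 : ℤ)) L
    rw [Finset.sum_range_succ, h0] at this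
    exact (add_right_cancel this).symm
  rw [Finset.sum_add_distrib, hshift, ← two_nsmul] at hp
  refine ⟨p, ?_, hp.symm⟩
  by_contra hodd
  rw [(Nat.not_odd_iff_even.1 hodd).neg_one_pow, hL.neg_one_pow, Int.units_mul_self] at hlen
  exact absurd hlen (by decide)

end Cyclic

/-- A sum of signed unit vectors permuted along alternating walks is an element of the edge
monoid plus half-sums of odd closed walks. -/
theorem exists_sum_eq_add_of_injective {P : Type*} [Finite P] {f : P → P}
    (hf : Function.Injective f) (c : P → ℤˣ × V)
    (hc : ∀ p, G.Alt (c p).1 (c p).2 (c (f p)).1 (c (f p)).2) (T : Finset P)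
    (hT : ∀ p ∈ T, f p ∈ T) :
    ∃ s ∈ G.edgeMonoid, ∃ l : List ((V →₀ ℤ) × V), (∀ x ∈ l, G.IsHalfOddClosed x.1 x.2) ∧
      ∑ p ∈ T, Finsupp.single (c p).2 ((c p).1 : ℤ) = s + (l.map Prod.fst).sum := by
  classical
  induction T using Finset.strongInduction with
  | H T ih =>
  rcases T.eq_empty_or_nonempty with rfl | ⟨p, hp⟩
  · exact ⟨0, zero_mem _, [], by simp, by simp⟩
  set L := Function.minimalPeriod f p with hL
  have hLpos : 0 < L := Function.minimalPeriod_pos_of_mem_periodicPts (hf.mem_periodicPts p)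
  have hLp : f^[L] p = p := Function.iterate_minimalPeriod
  set O : Finset P := (Finset.range L).image fun t => f^[t] p with hO
  have hiter : ∀ t, f^[t] p ∈ O := fun t => Finset.mem_image.2
    ⟨t % L, Finset.mem_range.2 (Nat.mod_lt _ hLpos), Function.iterate_mod_minimalPeriod_eq⟩
  have hOT : O ⊆ T := by
    intro q hq
    obtain ⟨t, -, rfl⟩ := Finset.mem_image.1 hq
    clear hq
    induction t with
    | zero => exact hp
    | succ t iht => rw [Function.iterate_succ_apply']; exact hT _ iht
  have hsub : T \ O ⊂ T := Finset.sdiff_ssubset hOT ⟨p, hiter 0⟩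
  obtain ⟨s, hs, l, hl, hsum⟩ := ih (T \ O) hsub fun q hq => by
    rw [Finset.mem_sdiff] at hq ⊢
    refine ⟨hT q hq.1, fun h => hq.2 ?_⟩
    obtain ⟨t, -, ht⟩ := Finset.mem_image.1 h
    -- The predecessor of the t-th iterate; adding the period keeps the exponent meaningful at t =
    -- 0.
    have : q = f^[t + L - 1] p := by
      apply hf
      rw [← Function.iterate_succ_apply' f, show (t + L - 1).succ = t + L by omega,
        Function.iterate_add_apply, hLp, ← ht]
    exact this ▸ hiter _
  have hOsum : ∑ q ∈ O, Finsupp.single (c q).2 ((c q).1 : ℤ) = ∑ t ∈ Finset.range L,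
      Finsupp.single (c (f^[t] p)).2 ((c (f^[t] p)).1 : ℤ) := by
    refine Finset.sum_image fun t ht t' ht' h => ?_
    exact Function.iterate_injOn_Iio_minimalPeriod (by simpa using ht) (by simpa using ht') h
  have hc' : ∀ n, G.Alt (c (f^[n] p)).1 (c (f^[n] p)).2 (c (f^[n + 1] p)).1 (c (f^[n + 1] p)).2 :=
    fun n => by
      rw [Function.iterate_succ_apply']
      exact hc _
  rw [← Finset.sum_sdiff hOT, hsum, hOsum]
  -- An even orbit is absorbed into s by pairing consecutive terms; an odd one is a new half-sum.
  rcases Nat.even_or_odd' L with ⟨r, hr | hr⟩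
  · refine ⟨_, add_mem hs (sum_range_two_mul_mem (c := fun n => c (f^[n] p)) hc' r), l, hl, ?_⟩
    rw [← hr]
    abel
  · refine ⟨s, hs, (∑ t ∈ Finset.range L,
      Finsupp.single (c (f^[t] p)).2 ((c (f^[t] p)).1 : ℤ), (c p).2) :: l, ?_, ?_⟩
    · intro x hx
      rcases List.mem_cons.1 hx with rfl | hx
      · exact isHalfOddClosed_sum_range (c := fun n => c (f^[n] p)) hc' ⟨r, hr⟩
          (by simp only [hLp, Function.iterate_zero_apply])
      · exact hl x hx
    · simp only [List.map_cons, List.sum_cons]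
      abel

theorem exists_eq_add_of_nsmul_mem [Finite V] {a : V →₀ ℤ} {m : ℕ} (hm : m ≠ 0)
    (ha : m • a ∈ G.edgeMonoid) :
    ∃ s ∈ G.edgeMonoid, ∃ l : List ((V →₀ ℤ) × V), (∀ x ∈ l, G.IsHalfOddClosed x.1 x.2) ∧
      a = s + (l.map Prod.fst).sum := by
  have := Fintype.ofFinite V
  obtain ⟨f, hf, halt⟩ := exists_injective_alt hm ha
  obtain ⟨s, hs, l, hl, h⟩ := exists_sum_eq_add_of_injective hf
    (fun p => (unitSign (a p.1), p.1)) halt Finset.univ (by simp)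
  exact ⟨s, hs, l, hl, (sum_sigma_fin_single a).symm.trans h⟩

/-! ### Parity in components, and normality from the odd cycle condition. -/

open Classical in
/-- The sum of the coordinates in the connected component of `u`. -/
noncomputable def componentSum (G : SignedGraph V) (u : V) : (V →₀ ℤ) →ₗ[ℤ] ℤ :=
  Finsupp.linearCombination ℤ fun v => if G.SameComponent u v then 1 else 0

theorem even_componentSum (u : V) {x : V →₀ ℤ}
    (hx : x ∈ AddSubgroup.closure (G.edgeMonoid : Set (V →₀ ℤ))) :
    Even (G.componentSum u x) := by
  have hle : AddSubgroup.closure (G.edgeMonoid : Set (V →₀ ℤ)) ≤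
      AddSubgroup.closure (rho '' G.edges) := by
    rw [AddSubgroup.closure_le]
    exact AddSubmonoid.closure_le (S := (AddSubgroup.closure (rho '' G.edges)).toAddSubmonoid).2
      AddSubgroup.subset_closure
  replace hx := hle hx
  induction hx using AddSubgroup.closure_induction with
  | zero => simp
  | add x y _ _ hx hy => rw [map_add]; exact hx.add hy
  | neg x _ hx => rw [map_neg]; exact hx.neg
  | mem x hx =>
    obtain ⟨⟨ε, e⟩, he, rfl⟩ := hx
    induction e using Sym2.ind with
    | _ i j =>
    have hij : G.SameComponent u i ↔ G.SameComponent u j :=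
      ⟨fun h => h.trans (sameComponent_of_mem_edges he),
        fun h => h.trans (sameComponent_of_mem_edges he).symm⟩
    rw [rho_mk, componentSum, map_add, Finsupp.linearCombination_single,
      Finsupp.linearCombination_single]
    by_cases h : G.SameComponent u j <;> simp [hij, h]

theorem even_componentSum_of_mem (u : V) {x : V →₀ ℤ} (hx : x ∈ G.edgeMonoid) :
    Even (G.componentSum u x) :=
  even_componentSum u (AddSubgroup.subset_closure hx)

theorem IsHalfOddClosed.sub_single_mem {w : V →₀ ℤ} {u : V} (h : G.IsHalfOddClosed w u) :
    w - Finsupp.single u 1 ∈ G.edgeMonoid := by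
  obtain ⟨p, hp, hw⟩ := h
  exact Walk.half_rhoSum_sub_single_mem hp hw p.start_mem_support 1

/-- Modulo the edge monoid w is e_u, so it is odd on the component of u alone. -/
theorem IsHalfOddClosed.odd_componentSum {w : V →₀ ℤ} {u v : V} (h : G.IsHalfOddClosed w u) :
    Odd (G.componentSum v w) ↔ G.SameComponent v u := by
  have heven := even_componentSum_of_mem v h.sub_single_mem
  have hw : G.componentSum v w = G.componentSum v (w - Finsupp.single u 1) +
      G.componentSum v (Finsupp.single u 1) := by rw [← map_add, sub_add_cancel]
  rw [hw, Int.odd_add', iff_true_right heven, componentSum, Finsupp.linearCombination_single]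
  split_ifs with huv <;> simp [huv]

theorem OddCycleCondition.isNormal [Finite V] (hG : G.OddCycleCondition) :
    G.edgeMonoid.IsNormal := by
  intro a haZ m hm hma
  obtain ⟨s, hs, l, hl, rfl⟩ := exists_eq_add_of_nsmul_mem hm hma
  clear hma
  induction hn : l.length using Nat.strong_induction_on generalizing s l with
  | _ n ih =>
  match l, hl, hn with
  | [], _, _ => simpa using hs
  | (w, u) :: l, hl, hn =>
    have hw := hl _ List.mem_cons_self
    -- A partner in the same component lets both half-sums be absorbed into s; without one, the
    -- component of u would have odd sum.
    by_cases hex : ∃ x ∈ l, G.SameComponent u x.2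
    · classical
      obtain ⟨x, hx, hux⟩ := hex
      obtain ⟨p, hp, hpw⟩ := hw
      obtain ⟨q, hq, hqx⟩ := hl x (List.mem_cons_of_mem _ hx)
      have hmem := hG.half_rhoSum_add_mem hp hq hpw hqx hux
      have hperm := ((List.perm_cons_erase hx).map Prod.fst).sum_eq
      have heq : s + (((w, u) :: l).map Prod.fst).sum =
          (s + (w + x.1)) + ((l.erase x).map Prod.fst).sum := by
        rw [List.map_cons, List.sum_cons, hperm, List.map_cons, List.sum_cons]
        abel
      rw [heq] at haZ ⊢
      refine ih (l.erase x).length ?_ _ (add_mem hs hmem) _ (fun y hy => ?_) haZ rfl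
      · rw [← hn, List.length_cons, List.length_erase_of_mem hx]
        omega
      · exact hl y (List.mem_cons_of_mem _ (List.mem_of_mem_erase hy))
    · exfalso
      push Not at hex
      have hrest : Even (G.componentSum u (l.map Prod.fst).sum) := by
        rw [map_list_sum]
        refine List.sum_induction Even (fun _ _ => Even.add) (by simp) fun z hz => ?_
        simp only [List.map_map, List.mem_map, Function.comp] at hz
        obtain ⟨y, hy, rfl⟩ := hz
        rw [← Int.not_odd_iff_even, (hl y (List.mem_cons_of_mem _ hy)).odd_componentSum]
        exact hex y hy
      have hodd : Odd (G.componentSum u w) := hw.odd_componentSum.2 (.refl u)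
      have heven := even_componentSum u haZ
      rw [List.map_cons, List.sum_cons, map_add, map_add] at heven
      exact Int.not_even_iff_odd.2
        ((even_componentSum_of_mem u hs).add_odd (hodd.add_even hrest)) heven

end SignedGraph

/-! ### The odd cycle condition from normality. -/

namespace SignedGraph

variable {V : Type*} {G : SignedGraph V}

theorem exists_isAlternating_of_isNormal [Finite V] (hS : G.edgeMonoid.IsNormal) {u v : V}
    {p : G.Walk u u} {q : G.Walk v v} (hp : Odd p.length) (hq : Odd q.length)
    (huv : G.SameComponent u v) (hdisj : ∀ x ∈ p.support, x ∉ q.support) :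
    ∃ i ∈ p.support, ∃ j ∈ q.support, ∃ P : G.Walk i j, P.IsAlternating := by
  classical
  have := Fintype.ofFinite V
  obtain ⟨w, hw⟩ := Walk.exists_half_rhoSum hp
  obtain ⟨z, hz⟩ := Walk.exists_half_rhoSum hq
  have hwp : ∀ x, w x ≠ 0 → x ∈ p.support := fun x hx => by
    by_contra h
    exact hx (Walk.half_rhoSum_apply_of_notMem hw h)
  have hzq : ∀ x, z x ≠ 0 → x ∈ q.support := fun x hx => by
    by_contra h
    exact hx (Walk.half_rhoSum_apply_of_notMem hz h)
  have hwu : w - Finsupp.single u 1 ∈ G.edgeMonoid :=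
    Walk.half_rhoSum_sub_single_mem hp hw p.start_mem_support 1
  have hzv : z - Finsupp.single v 1 ∈ G.edgeMonoid :=
    Walk.half_rhoSum_sub_single_mem hq hz q.start_mem_support 1
  have hmem : w + z ∈ G.edgeMonoid := by
    refine hS _ ?_ 2 two_ne_zero ?_
    · obtain ⟨r⟩ := huv
      have hcl : ∀ {x}, x ∈ G.edgeMonoid → x ∈ AddSubgroup.closure (G.edgeMonoid : Set (V →₀ ℤ)) :=
        fun h => AddSubgroup.subset_closure h
      obtain ⟨s, hs, h⟩ := r.exists_rhoSum_eq 1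
      rcases Int.units_eq_one_or ((-1) ^ r.length * 1) with h1 | h1 <;> rw [h1] at h
      -- A connecting walk of even length gives e_u - e_v in the group, hence w - z, which 2z
      -- corrects. An odd one gives e_u + e_v directly.
      · have : w + z = (w - Finsupp.single u 1) - (z - Finsupp.single v 1) + 2 • z +
            (r.rhoSum - 2 • s) := by
          rw [h, Units.val_one]
          abel
        rw [this, hz]
        exact add_mem (add_mem (sub_mem (hcl hwu) (hcl hzv)) (hcl q.rhoSum_mem))
          (sub_mem (hcl r.rhoSum_mem) (nsmul_mem (hcl hs) 2))
      · have : w + z = (w - Finsupp.single u 1) + (z - Finsupp.single v 1) +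
            (r.rhoSum - 2 • s) := by
          rw [h, Units.val_one, Units.val_neg, Units.val_one, Finsupp.single_neg]
          abel
        rw [this]
        exact add_mem (add_mem (hcl hwu) (hcl hzv))
          (sub_mem (hcl r.rhoSum_mem) (nsmul_mem (hcl hs) 2))
    · rw [nsmul_add, hw, hz]
      exact add_mem p.rhoSum_mem q.rhoSum_mem
  by_contra hno
  -- Alternating walks start at the support of w with the sign of the coordinate. By assumption none
  -- reaches `q`, so the potential vanishes on `q`.
  set X : Set (ℤˣ × V) := {x | 0 < (x.1 : ℤ) * w x.2} with hX
  have hXp : ∀ x ∈ X, x.2 ∈ p.support := fun x hx => hwp _ fun h => by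
    simp [hX, h] at hx
  have hq_dep : ∀ ε, ∀ x ∈ q.support, (ε, x) ∉ G.departing X := by
    rintro ε x hx (h | ⟨y, hy, h⟩)
    · exact hdisj x (hXp _ h) hx
    · obtain ⟨P, hP, -⟩ := h.exists_walk
      exact hno ⟨y.2, hXp _ hy, x, hx, P, hP⟩
  have hpos : ∀ x, 0 < w x → (1, x) ∈ G.departing X := fun x hx => Or.inl (by simpa [hX] using hx)
  have hneg : ∀ x, w x < 0 → (-1, x) ∈ G.departing X := fun x hx => Or.inl (by simpa [hX] using hx)
  obtain ⟨hle, heven⟩ := potential_nonpos_and_even X hmem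
  simp only [Finsupp.linearCombination_apply, smul_eq_mul, zero_mul, implies_true,
    Finsupp.sum_fintype] at hle heven
  have hzw : ∀ x, w x ≠ 0 → z x = 0 := fun x hx => by
    by_contra h
    exact hdisj x (hwp x hx) (hzq x h)
  have hterm : ∀ x, 0 ≤ (w + z) x * potential (G.departing X) x := by
    intro x
    rw [Finsupp.add_apply, potential]
    rcases lt_trichotomy (w x) 0 with h | h | h
    · rw [hzw x h.ne, add_zero, if_pos (hneg x h)]
      refine mul_nonneg_of_nonpos_of_nonpos h.le ?_
      split_ifs <;> simp
    · by_cases hx : z x = 0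
      · simp [h, hx]
      · simp [hq_dep _ x (hzq x hx)]
    · rw [hzw x h.ne', add_zero, if_pos (hpos x h)]
      refine mul_nonneg h.le ?_
      split_ifs <;> simp
  have hzero : ∑ x, (w + z) x * potential (G.departing X) x = 0 :=
    le_antisymm hle (Finset.sum_nonneg fun x _ => hterm x)
  have hzero' : ∀ x, (w + z) x * potential (G.departing X) x = 0 := fun x =>
    (Finset.sum_eq_zero_iff_of_nonneg fun x _ => hterm x).1 hzero x (Finset.mem_univ x)
  -- Vanishing of each term forces both signs at every vertex where w is nonzero, so the parity
  -- statement applies to the full coordinate sum of w.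
  have hboth : ∀ x, (w + z) x * bothSigns (G.departing X) x = w x := by
    intro x
    have h0 := hzero' x
    rw [Finsupp.add_apply, potential] at h0
    rw [Finsupp.add_apply, bothSigns]
    rcases lt_trichotomy (w x) 0 with h | h | h
    · have h1 := hneg x h
      rw [hzw x h.ne, add_zero] at h0 ⊢
      have := (mul_eq_zero.1 h0).resolve_left h.ne
      rw [if_pos h1] at this
      have h2 : (1, x) ∈ G.departing X := by
        by_contra h2
        rw [if_neg h2] at this
        omega
      rw [if_pos ⟨h2, h1⟩, mul_one]
    · by_cases hx : z x = 0
      · simp [h, hx]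
      · simp [hq_dep _ x (hzq x hx), h]
    · have h1 := hpos x h
      rw [hzw x h.ne', add_zero] at h0 ⊢
      have := (mul_eq_zero.1 h0).resolve_left h.ne'
      rw [if_pos h1] at this
      have h2 : (-1, x) ∈ G.departing X := by
        by_contra h2
        rw [if_neg h2] at this
        omega
      rw [if_pos ⟨h1, h2⟩, mul_one]
  have hwEven : Even (∑ x, w x) := by
    simpa only [hboth] using heven hzero
  have hsupp : ∀ x, ¬ G.SameComponent u x → w x = 0 := fun x hx => by
    by_contra h
    exact hx (p.sameComponent_of_mem_support (hwp x h))
  have hsum : G.componentSum u w = ∑ x, w x := by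
    rw [componentSum, Finsupp.linearCombination_apply, Finsupp.sum_fintype _ _ (by simp)]
    refine Finset.sum_congr rfl fun x _ => ?_
    split_ifs with hx
    · simp
    · simp [hsupp x hx]
  have hodd := (IsHalfOddClosed.odd_componentSum (v := u) ⟨p, hp, hw⟩).2 (.refl u)
  rw [hsum] at hodd
  exact Int.not_even_iff_odd.2 hodd hwEven

theorem oddCycleCondition_of_isNormal [Finite V] (hS : G.edgeMonoid.IsNormal) :
    G.OddCycleCondition := by
  intro u v C D hC hD
  by_cases huv : G.SameComponent u v
  · right
    by_cases hdisj : ∃ x, x ∈ C.support ∧ x ∈ D.support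
    · exact Or.inl hdisj
    · push Not at hdisj
      exact Or.inr (exists_isAlternating_of_isNormal hS hC.2 hD.2 huv hdisj)
  · exact Or.inl huv

theorem edgeRing_eq_monomialSubalgebra (k : Type*) [Field k] (G : SignedGraph V) :
    G.edgeRing k = AddMonoidAlgebra.monomialSubalgebra k G.edgeMonoid := by
  rw [edgeMonoid, ← AddMonoidAlgebra.adjoin_single_eq_monomialSubalgebra, edgeRing,
    Set.image_image]

end SignedGraph

theorem mainTheorem3 {V : Type*} [Finite V] (k : Type*) [Field k] (G : SignedGraph V) :
    (IsDomain (G.edgeRing k) ∧ IsIntegrallyClosed (G.edgeRing k)) ↔ G.OddCycleCondition := by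
  rw [SignedGraph.edgeRing_eq_monomialSubalgebra]
  constructor
  · rintro ⟨_, _⟩
    exact SignedGraph.oddCycleCondition_of_isNormal
      (AddMonoidAlgebra.isNormal_of_isIntegrallyClosed (k := k))
  · intro h
    exact ⟨inferInstance,
      -- Finiteness of `V` makes the edge set, hence the generating set of the monoid, finite.
      AddMonoidAlgebra.isIntegrallyClosed_of_isNormal (G.edges.toFinite.image _) h.isNormal⟩
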